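/- **Definitions.** Manifolds are smooth, finite-dimensional, Hausdorff, second countable and without boundary. A *smooth quasiloopoid* $G\rightrightarrows M$ consists of a manifold $G$, surjective submersions $\alpha,\beta:G\to M$ (target and source) onto an embedded submanifold of units $\varepsilon:M\hookrightarrow G$, with $\alpha$ and $\beta$ restricting to the identity on $M$, and a smooth multiplication $m:G^{(2)}\to G$, $m(g,h)=gh$, on $G^{(2)}=\{(g,h)\in G\times G:\beta(g)=\alpha(h)\}$, such that $\alpha(h)h=h$ and $g\beta(g)=g$ for all $g,h\in G$, and such that the translations $l_g:\alpha^{-1}(\beta(g))\to G$, $l_g(h)=gh$, and $r_h:\beta^{-1}(\alpha(h))\to G$, $r_h(g)=gh$, are injective immersions. It has the *Inverse Property* if there is a diffeomorphism $\iota:G\to G$, $\iota(g)=g^{-1}$, such that for all $g,h$: if $\beta(g)=\alpha(h)$, then $g^{-1}(gh)$ is defined and equals $h$; if $\beta(h)=\alpha(g)$, then $(hg)g^{-1}$ is defined and equals $h$. A smooth quasiloopoid with the Inverse Property is called a *smooth I.P. loopoid*. Let $AG=TG|_M/TM$ be the normal bundle of $M$ in $G$. For a smooth section $X$ of $AG$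 and $a\in M$, let $\bar X^\alpha(a)$ and $\bar X^\beta(a)$ be the unique representatives of $X(a)$ in $T_aG$ that are tangent to the fibre of $\alpha$, respectively of $\beta$, through $a$. The *left* and *right prolongations* of $X$ are the vector fields on $G$ $$\overleftarrow{X}(g)=(T_{\beta(g)}l_g)\big(\bar X^\alpha(\beta(g))\big),\qquad \overrightarrow{X}(g)=(T_{\alpha(g)}r_g)\big(\bar X^\beta(\alpha(g))\big).$$ For sections $X,Y$ of $AG$ and $a\in M$, let $[X,Y]_l(a)$ and $[X,Y]_r(a)$ be the classes in $A_aG$ of $[\overleftarrow{X},\overleftarrow{Y}](a)$ and $[\overrightarrow{X},\overrightarrow{Y}](a)$, respectively. **Theorem.** Let $G\rightrightarrows M$ be a smooth I.P. loopoid. Then the left and right prolongations of every smooth section of $AG$ are smooth vector fields on $G$ (so that the two brackets are defined), and for all smooth sections $X,Y$ of $AG$ $$[X,Y]_l=-[X,Y]_r .$$ -/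

import Mathlib

open scoped Manifold ContDiff Topology

noncomputable section

/-- A smooth quasiloopoid `G ⇉ M`: a manifold `G` with surjective submersions `α, β : G → M`
(target and source) onto a submanifold of units, given by the embedding `ε : M → G`, and a smooth
multiplication `gh`, defined iff `β g = α h`, for which the elements of `ε(M)` are units and
whose translations are injective immersions of the `α`- and `β`-fibres.

The multiplication is written as a total function, but only its values on the set `G⁽²⁾` of
composable pairs are ever used. -/
structure SmoothQuasiloopoid
    {E : Type*} [NormedAddCommGroup E] [NormedSpace ℝ E] {H : Type*} [TopologicalSpace H]
    (I : ModelWithCorners ℝ E H)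
    {F : Type*} [NormedAddCommGroup F] [NormedSpace ℝ F] {K : Type*} [TopologicalSpace K]
    (J : ModelWithCorners ℝ F K)
    (G : Type*) [TopologicalSpace G] [ChartedSpace H G]
    (M : Type*) [TopologicalSpace M] [ChartedSpace K M] where
  /-- the target map -/
  α : G → M
  /-- the source map -/
  β : G → M
  /-- the embedding of the submanifold of units -/
  ε : M → G
  /-- the multiplication `gh`, meaningful only if `β g = α h` -/
  mul : G → G → G
  surjective_α : Function.Surjective α
  surjective_β : Function.Surjective β
  isSubmersion_α : Manifold.IsSubmersion I J ∞ α
  isSubmersion_β : Manifold.IsSubmersion I J ∞ β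
  isSmoothEmbedding_ε : Manifold.IsSmoothEmbedding J I ∞ ε
  /-- `α` and `β` restrict to the identity on the units (this says that the products `α(h) h`
  and `g β(g)` are defined) -/
  α_ε : ∀ a, α (ε a) = a
  β_ε : ∀ a, β (ε a) = a
  /-- `α(h) h = h` -/
  unit_mul : ∀ h, mul (ε (α h)) h = h
  /-- `g β(g) = g` -/
  mul_unit : ∀ g, mul g (ε (β g)) = g
  /-- the multiplication is smooth on the submanifold `G⁽²⁾` of `G × G` -/
  smooth_mul : ContMDiffOn (I.prod I) I ∞ (fun p : G × G => mul p.1 p.2) {p | β p.1 = α p.2}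
  /-- `l_g` is injective on the fibre `α⁻¹(β g)` -/
  injective_left : ∀ g, Set.InjOn (fun h => mul g h) (α ⁻¹' {β g})
  /-- `r_h` is injective on the fibre `β⁻¹(α h)` -/
  injective_right : ∀ h, Set.InjOn (fun g => mul g h) (β ⁻¹' {α h})
  /-- `l_g` is an immersion: `T l_g` is injective on the tangent spaces `ker Tα` of the fibre -/
  immersion_left : ∀ g h, β g = α h → ∀ v : TangentSpace I h, mfderiv I J α h v = 0 →
    mfderivWithin I I (fun h' => mul g h') (α ⁻¹' {β g}) h v = 0 → v = 0
  /-- `r_h` is an immersion: `T r_h` is injective on the tangent spaces `ker Tβ` of the fibre -/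
  immersion_right : ∀ g h, β g = α h → ∀ v : TangentSpace I g, mfderiv I J β g v = 0 →
    mfderivWithin I I (fun g' => mul g' h) (β ⁻¹' {α h}) g v = 0 → v = 0

namespace SmoothQuasiloopoid

variable {E : Type*} [NormedAddCommGroup E] [NormedSpace ℝ E] {H : Type*} [TopologicalSpace H]
  {I : ModelWithCorners ℝ E H}
  {F : Type*} [NormedAddCommGroup F] [NormedSpace ℝ F] {K : Type*} [TopologicalSpace K]
  {J : ModelWithCorners ℝ F K}
  {G : Type*} [TopologicalSpace G] [ChartedSpace H G]
  {M : Type*} [TopologicalSpace M] [ChartedSpace K M]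

/-- `ι` is a smooth inverse: `g⁻¹(gh) = h` and `(hg)g⁻¹ = h` for all composable pairs, the outer
products being defined. -/
structure IsInverse (Q : SmoothQuasiloopoid I J G M) (ι : G ≃ₘ⟮I, I⟯ G) : Prop where
  composable_left : ∀ g h, Q.β g = Q.α h → Q.β (ι g) = Q.α (Q.mul g h)
  inv_mul : ∀ g h, Q.β g = Q.α h → Q.mul (ι g) (Q.mul g h) = h
  composable_right : ∀ h g, Q.β h = Q.α g → Q.β (Q.mul h g) = Q.α (ι g)
  mul_inv : ∀ h g, Q.β h = Q.α g → Q.mul (Q.mul h g) (ι g) = h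

/-- The Inverse Property (I.P.). -/
def HasInverseProperty (Q : SmoothQuasiloopoid I J G M) : Prop :=
  ∃ ι : G ≃ₘ⟮I, I⟯ G, Q.IsInverse ι

/-- The tangent space to the submanifold of units, as a subspace of `T_{ε a} G`. -/
def unitTangent (Q : SmoothQuasiloopoid I J G M) (a : M) : Submodule ℝ (TangentSpace I (Q.ε a)) :=
  (mfderiv J I Q.ε a).toLinearMap.range

/-- The fibre at `a` of the normal bundle `AG = TG|_M / TM`. -/
abbrev Normal (Q : SmoothQuasiloopoid I J G M) (a : M) : Type _ :=
  TangentSpace I (Q.ε a) ⧸ Q.unitTangent a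

theorem mfderiv_α_comp_ε (Q : SmoothQuasiloopoid I J G M) (a : M) (v : TangentSpace J a) :
    (mfderiv I J Q.α (Q.ε a) (mfderiv J I Q.ε a v) : F) = v := by
  have hα : MDifferentiableAt I J Q.α (Q.ε a) :=
    Q.isSubmersion_α.contMDiff.mdifferentiable (by simp) _
  have hε : MDifferentiableAt J I Q.ε a :=
    Q.isSmoothEmbedding_ε.isImmersion.contMDiff.mdifferentiable (by simp) _
  have h := mfderiv_comp a hα hε
  have h2 : Q.α ∘ Q.ε = id := funext Q.α_ε
  rw [h2, mfderiv_id] at h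
  exact (DFunLike.congr_fun h v).symm

theorem mfderiv_β_comp_ε (Q : SmoothQuasiloopoid I J G M) (a : M) (v : TangentSpace J a) :
    (mfderiv I J Q.β (Q.ε a) (mfderiv J I Q.ε a v) : F) = v := by
  have hβ : MDifferentiableAt I J Q.β (Q.ε a) :=
    Q.isSubmersion_β.contMDiff.mdifferentiable (by simp) _
  have hε : MDifferentiableAt J I Q.ε a :=
    Q.isSmoothEmbedding_ε.isImmersion.contMDiff.mdifferentiable (by simp) _
  have h := mfderiv_comp a hβ hε
  have h2 : Q.β ∘ Q.ε = id := funext Q.β_ε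
  rw [h2, mfderiv_id] at h
  exact (DFunLike.congr_fun h v).symm

/-- Each class in `AG` at `a` has exactly one representative tangent to the `α`-fibre. -/
theorem existsUnique_alphaRep (Q : SmoothQuasiloopoid I J G M) (a : M) (x : Q.Normal a) :
    ∃! v : TangentSpace I (Q.ε a),
      mfderiv I J Q.α (Q.ε a) v = 0 ∧ (Submodule.Quotient.mk v : Q.Normal a) = x := by
  obtain ⟨w, rfl⟩ := Submodule.Quotient.mk_surjective _ x
  refine ⟨w - mfderiv J I Q.ε a (show F from mfderiv I J Q.α (Q.ε a) w), ⟨?_, ?_⟩, ?_⟩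
  · rw [map_sub, sub_eq_zero]
    exact (Q.mfderiv_α_comp_ε a _).symm
  · rw [Submodule.Quotient.eq]
    refine ⟨-(show F from mfderiv I J Q.α (Q.ε a) w), ?_⟩
    exact (map_neg (mfderiv J I Q.ε a) (show F from mfderiv I J Q.α (Q.ε a) w)).trans (by abel)
  · rintro v ⟨hv, hvw⟩
    rw [Submodule.Quotient.eq] at hvw
    obtain ⟨u, hu⟩ := hvw
    have hu' : mfderiv J I Q.ε a u = v - w := hu
    have h1 := Q.mfderiv_α_comp_ε a u
    rw [hu', map_sub, hv, zero_sub] at h1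
    have h2 : (show F from mfderiv I J Q.α (Q.ε a) w) = -u := by
      rw [← h1]; exact (neg_neg _).symm
    rw [h2]
    exact (sub_eq_iff_eq_add'.mp hu'.symm).trans
      ((sub_neg_eq_add w _).symm.trans (congrArg (w - ·) (map_neg (mfderiv J I Q.ε a) u).symm))

/-- Each class in `AG` at `a` has exactly one representative tangent to the `β`-fibre. -/
theorem existsUnique_betaRep (Q : SmoothQuasiloopoid I J G M) (a : M) (x : Q.Normal a) :
    ∃! v : TangentSpace I (Q.ε a),
      mfderiv I J Q.β (Q.ε a) v = 0 ∧ (Submodule.Quotient.mk v : Q.Normal a) = x := by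
  obtain ⟨w, rfl⟩ := Submodule.Quotient.mk_surjective _ x
  refine ⟨w - mfderiv J I Q.ε a (show F from mfderiv I J Q.β (Q.ε a) w), ⟨?_, ?_⟩, ?_⟩
  · rw [map_sub, sub_eq_zero]
    exact (Q.mfderiv_β_comp_ε a _).symm
  · rw [Submodule.Quotient.eq]
    refine ⟨-(show F from mfderiv I J Q.β (Q.ε a) w), ?_⟩
    exact (map_neg (mfderiv J I Q.ε a) (show F from mfderiv I J Q.β (Q.ε a) w)).trans (by abel)
  · rintro v ⟨hv, hvw⟩
    rw [Submodule.Quotient.eq] at hvw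
    obtain ⟨u, hu⟩ := hvw
    have hu' : mfderiv J I Q.ε a u = v - w := hu
    have h1 := Q.mfderiv_β_comp_ε a u
    rw [hu', map_sub, hv, zero_sub] at h1
    have h2 : (show F from mfderiv I J Q.β (Q.ε a) w) = -u := by
      rw [← h1]; exact (neg_neg _).symm
    rw [h2]
    exact (sub_eq_iff_eq_add'.mp hu'.symm).trans
      ((sub_neg_eq_add w _).symm.trans (congrArg (w - ·) (map_neg (mfderiv J I Q.ε a) u).symm))

/-- `X̄^α`: the representative of `x` tangent to the `α`-fibre through `ε a`. -/
def alphaRep (Q : SmoothQuasiloopoid I J G M) (a : M) (x : Q.Normal a) : TangentSpace I (Q.ε a) :=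
  (Q.existsUnique_alphaRep a x).choose

/-- `X̄^β`: the representative of `x` tangent to the `β`-fibre through `ε a`. -/
def betaRep (Q : SmoothQuasiloopoid I J G M) (a : M) (x : Q.Normal a) : TangentSpace I (Q.ε a) :=
  (Q.existsUnique_betaRep a x).choose

/-- A smooth section of `AG`: locally it is represented by smooth sections of `TG` along `ε`. -/
structure NormalSection [IsManifold I ∞ G] (Q : SmoothQuasiloopoid I J G M) where
  /-- the value of the section at a point of `M` -/
  toFun : ∀ a : M, Q.Normal a
  smooth : ∀ a : M, ∃ U ∈ 𝓝 a, ∃ Y : ∀ b : M, TangentSpace I (Q.ε b),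
    ContMDiffOn J I.tangent ∞ (fun b => (⟨Q.ε b, Y b⟩ : TangentBundle I G)) U ∧
      ∀ b ∈ U, (Submodule.Quotient.mk (Y b) : Q.Normal b) = toFun b

variable [IsManifold I ∞ G]

/-- The left prolongation `g ↦ (T_{β(g)} l_g)(X̄^α(β(g)))`, a vector field on `G`.
The derivative of `l_g` is taken within the `α`-fibre `α⁻¹(β(g))`; on vectors tangent to the fibre
it is the tangent map of `l_g : α⁻¹(β(g)) → G`. The result lies in the tangent space at
`g β(g) = g`. -/
def leftProlongation (Q : SmoothQuasiloopoid I J G M) (X : Q.NormalSection) (g : G) :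
    TangentSpace I g :=
  Q.mul_unit g ▸ mfderivWithin I I (fun h => Q.mul g h) (Q.α ⁻¹' {Q.β g}) (Q.ε (Q.β g))
    (Q.alphaRep (Q.β g) (X.toFun (Q.β g)))

/-- The right prolongation `g ↦ (T_{α(g)} r_g)(X̄^β(α(g)))`, a vector field on `G`.
The derivative of `r_g` is taken within the `β`-fibre `β⁻¹(α(g))`; on vectors tangent to the fibre
it is the tangent map of `r_g : β⁻¹(α(g)) → G`. The result lies in the tangent space at
`α(g) g = g`. -/
def rightProlongation (Q : SmoothQuasiloopoid I J G M) (X : Q.NormalSection) (g : G) :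
    TangentSpace I g :=
  Q.unit_mul g ▸ mfderivWithin I I (fun h => Q.mul h g) (Q.β ⁻¹' {Q.α g}) (Q.ε (Q.α g))
    (Q.betaRep (Q.α g) (X.toFun (Q.α g)))

/-- The left bracket: `[X, Y]_l(a)` is the class in `AG` of the Lie bracket of the left
prolongations of `X` and `Y` at the unit `a`. -/
def leftBracket (Q : SmoothQuasiloopoid I J G M) (X Y : Q.NormalSection) (a : M) : Q.Normal a :=
  Submodule.Quotient.mk
    (VectorField.mlieBracket I (Q.leftProlongation X) (Q.leftProlongation Y) (Q.ε a))

/-- The right bracket: `[X, Y]_r(a)` is the class in `AG` of the Lie bracket of the right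
prolongations of `X` and `Y` at the unit `a`. -/
def rightBracket (Q : SmoothQuasiloopoid I J G M) (X Y : Q.NormalSection) (a : M) : Q.Normal a :=
  Submodule.Quotient.mk
    (VectorField.mlieBracket I (Q.rightProlongation X) (Q.rightProlongation Y) (Q.ε a))

end SmoothQuasiloopoid
end

/-! Everything follows from the inversion `ι`. The Inverse Property alone, without associativity,
makes `ι` swap `α` and `β`, fix the units and reverse products (`inv_mul_rev`).

Differentiating `h⁻¹h = β(h)` at a unit along the `α`-fibre gives `Tι v + v ∈ TM`, so `Tι` acts as
`-1` on `AG` (`mk_mfderiv_inv`). With `ι(gh) = ι(h)ι(g)` this shows that `ι` pulls a right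
prolongation back to minus the left one (`mpullback_rightProlongation`). In the bracket of two
prolongations these signs cancel, so `Tι` carries the left bracket field at a unit to the right one;
passing to classes in `AG` then contributes the single sign of the theorem.

For smoothness, retractions onto the fibres of `α` extend the product smoothly off `G⁽²⁾` to some
`μ`, and the left prolongation is `Tμ(0_g, X̄^α(β g))`. The right one is minus its push-forward by
`ι`. -/

/-! ### Retractions onto the fibres of a submersion -/

section Submersion

open Manifold

variable {E : Type*} [NormedAddCommGroup E] [NormedSpace ℝ E] {H : Type*} [TopologicalSpace H]
  {I : ModelWithCorners ℝ E H} [I.Boundaryless]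
  {F : Type*} [NormedAddCommGroup F] [NormedSpace ℝ F] {K : Type*} [TopologicalSpace K]
  {J : ModelWithCorners ℝ F K}
  {G : Type*} [TopologicalSpace G] [ChartedSpace H G]
  {M : Type*} [TopologicalSpace M] [ChartedSpace K M]

/-- Near a point `x` of its domain a submersion `f` has a smooth family `ρ (b, ·)` of retractions
onto its fibres `f ⁻¹' {b}`. -/
theorem Manifold.IsSubmersionAt.exists_fibre_retractions {n : WithTop ℕ∞} {f : G → M} {x : G}
    (hf : IsSubmersionAt I J n f x) :
    ∃ (ρ : M × G → G) (U : Set (M × G)), IsOpen U ∧ (f x, x) ∈ U ∧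
      ContMDiffOn (J.prod I) I n ρ U ∧ (∀ p ∈ U, f (ρ p) = p.1) ∧
      ∀ y, (f y, y) ∈ U → ρ (f y, y) = y := by
  obtain ⟨C, _, _, h⟩ := hf
  let φ := h.domChart.extend I
  let ψ := h.codChart.extend J
  let e := h.equiv
  have hφs : φ.source = h.domChart.source := h.domChart.extend_source
  have hψs : ψ.source = h.codChart.source := h.codChart.extend_source
  have hw : ∀ z ∈ φ.target, ψ (f (φ.symm z)) = (e z).1 := fun z hz => h.writtenInCharts hz
  have hfw : ∀ y ∈ φ.source, ψ (f y) = (e (φ y)).1 := fun y hy => by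
    rw [← hw _ (φ.map_source hy), φ.left_inv hy]
  have hmaps : ∀ y ∈ φ.source, f y ∈ ψ.source := fun y hy => by
    rw [hψs]; exact h.mapsto_domChart_source_codChart_source (hφs ▸ hy)
  -- In the normal form `f` is the projection `F × C → F`: keep the `C`-coordinate of the point and
  -- replace its `F`-coordinate by that of `b`.
  let τ : M × G → E := fun p => e.symm (ψ p.1, (e (φ p.2)).2)
  have hτf : ∀ y ∈ φ.source, τ (f y, y) = φ y := fun y hy => by
    simp only [τ, hfw y hy, Prod.mk.eta, ContinuousLinearEquiv.symm_apply_apply]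
  let S : Set (M × G) := h.codChart.source ×ˢ h.domChart.source
  have hSo : IsOpen S := h.codChart.open_source.prod h.domChart.open_source
  have hτ : ContMDiffOn (J.prod I) 𝓘(ℝ, E) n τ S := by
    have h1 : ContMDiffOn (J.prod I) 𝓘(ℝ, F) n (fun p : M × G => ψ p.1) S :=
      (h.codChart.contMDiffOn_extend h.codChart_mem_maximalAtlas).comp
        contMDiff_fst.contMDiffOn fun p hp => hp.1
    have h2 : ContMDiffOn (J.prod I) 𝓘(ℝ, E) n (fun p : M × G => φ p.2) S :=
      (h.domChart.contMDiffOn_extend h.domChart_mem_maximalAtlas).comp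
        contMDiff_snd.contMDiffOn fun p hp => hp.2
    have h3 : ContMDiff 𝓘(ℝ, E) 𝓘(ℝ, C) n (fun z : E => (e z).2) := by
      rw [contMDiff_iff_contDiff]; fun_prop
    have h4 : ContMDiff 𝓘(ℝ, F × C) 𝓘(ℝ, E) n (fun z : F × C => e.symm z) := by
      rw [contMDiff_iff_contDiff]; fun_prop
    exact h4.comp_contMDiffOn (h1.prodMk_space (h3.comp_contMDiffOn h2))
  have hTo : IsOpen φ.target := h.domChart.isOpen_extend_target
  refine ⟨fun p => φ.symm (τ p), S ∩ τ ⁻¹' φ.target,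
    hτ.continuousOn.isOpen_inter_preimage hSo hTo, ⟨⟨?_, h.mem_domChart_source⟩, ?_⟩, ?_, ?_, ?_⟩
  · exact h.mem_codChart_source
  · have hx : x ∈ φ.source := hφs ▸ h.mem_domChart_source
    rw [Set.mem_preimage, hτf x hx]
    exact φ.map_source hx
  · refine (contMDiffOn_extend_symm h.domChart_mem_maximalAtlas).comp
      (hτ.mono Set.inter_subset_left) fun p hp => ?_
    rw [← h.domChart.extend_target']
    exact hp.2
  · rintro p ⟨hp, hpt⟩
    refine ψ.injOn (hmaps _ (φ.map_target hpt)) (hψs ▸ hp.1) ?_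
    rw [hw _ hpt]
    simp [τ]
  · rintro y ⟨hy, -⟩
    have hy' : y ∈ φ.source := hφs ▸ hy.2
    change φ.symm (τ (f y, y)) = y
    rw [hτf y hy', φ.left_inv hy']

/-- Near a point `x` there is a retraction `θ` onto the fibre of a submersion `f` through `x`; its
derivative at `x` fixes the vectors tangent to the fibre. -/
theorem Manifold.IsSubmersionAt.exists_fibre_retraction [IsManifold I ∞ G] {f : G → M} {x : G}
    (hf : IsSubmersionAt I J ∞ f x) :
    ∃ (θ : G → G) (θ' : E →L[ℝ] E), θ x = x ∧ (∀ᶠ y in 𝓝 x, f (θ y) = f x) ∧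
      HasMFDerivAt I I θ x θ' ∧
      ∀ v : TangentSpace I x, mfderiv I J f x v = 0 → θ' v = v := by
  obtain ⟨ρ, U, hUo, hxU, hρ, hfρ, hρf⟩ := hf.exists_fibre_retractions
  have hρd : MDifferentiableAt (J.prod I) I ρ (f x, x) :=
    (hρ.contMDiffAt (hUo.mem_nhds hxU)).mdifferentiableAt (by simp)
  have hfd : MDifferentiableAt I J f x := hf.contMDiffAt.mdifferentiableAt (by simp)
  have hc : HasMFDerivAt I (J.prod I) (fun y => (f x, y)) x _ :=
    (hasMFDerivAt_const (f x) x).prodMk (hasMFDerivAt_id x)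
  have hg : HasMFDerivAt I (J.prod I) (fun y => (f y, y)) x _ :=
    hfd.hasMFDerivAt.prodMk (hasMFDerivAt_id x)
  have h1 := hρd.hasMFDerivAt.comp x hc
  have h2 := HasMFDerivAt.comp (f := fun y => (f y, y)) x hρd.hasMFDerivAt hg
  -- `ρ (f y, y)` is `y`, while `θ y` is `ρ (f x, y)`. The derivatives of the two inner maps differ
  -- only by `Tf`, hence agree on its kernel.
  have h3 : HasMFDerivAt I I (ρ ∘ fun y => (f y, y)) x (ContinuousLinearMap.id ℝ E) := by
    refine (hasMFDerivAt_id x).congr_of_eventuallyEq ?_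
    filter_upwards [hg.continuousAt.preimage_mem_nhds (hUo.mem_nhds hxU)] with y hy
    exact hρf y hy
  refine ⟨_, _, hρf x hxU, ?_, h1, ?_⟩
  · filter_upwards [hc.continuousAt.preimage_mem_nhds (hUo.mem_nhds hxU)] with y hy
    exact hfρ _ hy
  · intro v hv
    have h4 := DFunLike.congr_fun (hasMFDerivAt_unique h2 h3) v
    refine Eq.trans ?_ h4
    change mfderiv (J.prod I) I ρ (f x, x) ((0 : F), v) =
      mfderiv (J.prod I) I ρ (f x, x) ((mfderiv I J f x v : F), v)
    exact congrArg (fun w : F => mfderiv (J.prod I) I ρ (f x, x) (w, v)) hv.symm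

/-- Two maps which agree on a fibre of a submersion have the same derivatives in the directions
tangent to the fibre. -/
theorem Manifold.IsSubmersionAt.hasMFDerivWithinAt_fibre_eq [IsManifold I ∞ G]
    {E' : Type*} [NormedAddCommGroup E'] [NormedSpace ℝ E'] {H' : Type*} [TopologicalSpace H']
    {I' : ModelWithCorners ℝ E' H'} {N : Type*} [TopologicalSpace N] [ChartedSpace H' N]
    {f : G → M} {x : G} {c : M}
    (hf : IsSubmersionAt I J ∞ f x) (hc : f x = c) {u₁ u₂ : G → N}
    {u₁' u₂' : E →L[ℝ] E'}
    (h₁ : HasMFDerivWithinAt I I' u₁ (f ⁻¹' {c}) x u₁')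
    (h₂ : HasMFDerivWithinAt I I' u₂ (f ⁻¹' {c}) x u₂')
    (h : u₁ =ᶠ[𝓝[f ⁻¹' {c}] x] u₂) (v : TangentSpace I x) (hv : mfderiv I J f x v = 0) :
    u₁' v = u₂' v := by
  subst hc
  obtain ⟨θ, θ', hθx, hθ, hθd, hθv⟩ := hf.exists_fibre_retraction
  -- A derivative within the fibre need not be unique. Composition with `θ`, which lands in the
  -- fibre near `x`, gives an ordinary derivative, which is unique.
  have key : ∀ (u : G → N) (u' : E →L[ℝ] E'), HasMFDerivWithinAt I I' u (f ⁻¹' {f x}) x u' →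
      HasMFDerivAt I I' (u ∘ θ) x (u'.comp θ') := by
    intro u u' hu
    have h3 : HasMFDerivWithinAt I I' u (f ⁻¹' {f x}) (θ x) u' := by rw [hθx]; exact hu
    exact (h3.comp x (hθd.hasMFDerivWithinAt (s := {y | f (θ y) = f x})) fun y hy => hy).hasMFDerivAt
      hθ
  have hx : Filter.Tendsto θ (𝓝 x) (𝓝[f ⁻¹' {f x}] x) := by
    refine tendsto_nhdsWithin_iff.2 ⟨?_, hθ⟩
    have := hθd.continuousAt.tendsto
    rwa [hθx] at this
  have h4 := hasMFDerivAt_unique (key u₁ u₁' h₁)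
    ((key u₂ u₂' h₂).congr_of_eventuallyEq (hx.eventually h))
  have h5 : u₁' (θ' v) = u₂' (θ' v) := DFunLike.congr_fun h4 v
  rwa [hθv v hv] at h5

end Submersion

/-! ### Sections of a vector bundle along a map -/

section SectionAlong

open Bundle FiberBundle Filter

/-- The difference of two smooth sections of a vector bundle along a map `b` is smooth. -/
theorem ContMDiffWithinAt.sub_section_along {𝕜 : Type*} [NontriviallyNormedField 𝕜]
    {E₁ : Type*} [NormedAddCommGroup E₁] [NormedSpace 𝕜 E₁] {H₁ : Type*} [TopologicalSpace H₁]
    {I₁ : ModelWithCorners 𝕜 E₁ H₁} {N : Type*} [TopologicalSpace N] [ChartedSpace H₁ N]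
    {E₂ : Type*} [NormedAddCommGroup E₂] [NormedSpace 𝕜 E₂] {H₂ : Type*} [TopologicalSpace H₂]
    {I₂ : ModelWithCorners 𝕜 E₂ H₂} {B : Type*} [TopologicalSpace B] [ChartedSpace H₂ B]
    {E₃ : Type*} [NormedAddCommGroup E₃] [NormedSpace 𝕜 E₃] {V : B → Type*}
    [TopologicalSpace (TotalSpace E₃ V)] [∀ x, TopologicalSpace (V x)] [∀ x, AddCommGroup (V x)]
    [∀ x, Module 𝕜 (V x)] [FiberBundle E₃ V] [VectorBundle 𝕜 E₃ V] {n : WithTop ℕ∞}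
    {b : N → B} {s t : ∀ x, V (b x)} {u : Set N} {x₀ : N}
    (hs : ContMDiffWithinAt I₁ (I₂.prod 𝓘(𝕜, E₃)) n
      (fun x => (⟨b x, s x⟩ : TotalSpace E₃ V)) u x₀)
    (ht : ContMDiffWithinAt I₁ (I₂.prod 𝓘(𝕜, E₃)) n
      (fun x => (⟨b x, t x⟩ : TotalSpace E₃ V)) u x₀) :
    ContMDiffWithinAt I₁ (I₂.prod 𝓘(𝕜, E₃)) n
      (fun x => (⟨b x, s x - t x⟩ : TotalSpace E₃ V)) u x₀ := by
  rw [contMDiffWithinAt_totalSpace] at hs ht ⊢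
  refine ⟨hs.1, ?_⟩
  let e := trivializationAt E₃ V (b x₀)
  refine (hs.2.sub ht.2).congr_of_eventuallyEq ?_ ?_
  · filter_upwards [hs.1.continuousWithinAt.preimage_mem_nhdsWithin
      (e.open_baseSet.mem_nhds (mem_baseSet_trivializationAt E₃ V (b x₀)))] with x hx
    exact (e.linear 𝕜 hx).map_sub _ _
  · exact (e.linear 𝕜 (mem_baseSet_trivializationAt E₃ V (b x₀))).map_sub _ _

end SectionAlong

/-! ### Smoothness of left prolongations -/

namespace SmoothQuasiloopoid

variable {E : Type*} [NormedAddCommGroup E] [NormedSpace ℝ E] {H : Type*} [TopologicalSpace H]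
  {I : ModelWithCorners ℝ E H}
  {F : Type*} [NormedAddCommGroup F] [NormedSpace ℝ F] {K : Type*} [TopologicalSpace K]
  {J : ModelWithCorners ℝ F K}
  {G : Type*} [TopologicalSpace G] [ChartedSpace H G]
  {M : Type*} [TopologicalSpace M] [ChartedSpace K M]

theorem contMDiff_ε (Q : SmoothQuasiloopoid I J G M) : ContMDiff J I ∞ Q.ε :=
  Q.isSmoothEmbedding_ε.isImmersion.contMDiff

theorem mfderiv_α_alphaRep (Q : SmoothQuasiloopoid I J G M) (a : M) (x : Q.Normal a) :
    mfderiv I J Q.α (Q.ε a) (Q.alphaRep a x) = 0 :=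
  (Q.existsUnique_alphaRep a x).choose_spec.1.1

theorem mk_alphaRep (Q : SmoothQuasiloopoid I J G M) (a : M) (x : Q.Normal a) :
    (Submodule.Quotient.mk (Q.alphaRep a x) : Q.Normal a) = x :=
  (Q.existsUnique_alphaRep a x).choose_spec.1.2

theorem eq_alphaRep (Q : SmoothQuasiloopoid I J G M) {a : M} {x : Q.Normal a}
    {v : TangentSpace I (Q.ε a)} (hv : mfderiv I J Q.α (Q.ε a) v = 0)
    (hx : (Submodule.Quotient.mk v : Q.Normal a) = x) : v = Q.alphaRep a x :=
  (Q.existsUnique_alphaRep a x).choose_spec.2 v ⟨hv, hx⟩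

theorem eq_betaRep (Q : SmoothQuasiloopoid I J G M) {a : M} {x : Q.Normal a}
    {v : TangentSpace I (Q.ε a)} (hv : mfderiv I J Q.β (Q.ε a) v = 0)
    (hx : (Submodule.Quotient.mk v : Q.Normal a) = x) : v = Q.betaRep a x :=
  (Q.existsUnique_betaRep a x).choose_spec.2 v ⟨hv, hx⟩

/-- The projection of `T_{ε a} G` onto the tangent space of the `α`-fibre along `T M`. -/
theorem alphaRep_mk (Q : SmoothQuasiloopoid I J G M) (a : M) (w : TangentSpace I (Q.ε a)) :
    Q.alphaRep a (Submodule.Quotient.mk w) =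
      w - mfderiv J I Q.ε a (show F from mfderiv I J Q.α (Q.ε a) w) := by
  refine (Q.eq_alphaRep ?_ ?_).symm
  · rw [map_sub, sub_eq_zero]
    exact (Q.mfderiv_α_comp_ε a _).symm
  · rw [Submodule.Quotient.eq]
    refine ⟨-(show F from mfderiv I J Q.α (Q.ε a) w), ?_⟩
    exact (map_neg (mfderiv J I Q.ε a) (show F from mfderiv I J Q.α (Q.ε a) w)).trans (by abel)

/-- All tangent spaces are the model space `E`, so vectors over propositionally equal base points,
such as `g β(g)` and `g`, can be compared in `E`. -/
theorem tangentBundle_mk_eq {x y : G} (h : x = y) {v : TangentSpace I x} {w : TangentSpace I y}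
    (hvw : (v : E) = w) : (⟨x, v⟩ : TangentBundle I G) = ⟨y, w⟩ := by
  subst h; exact congrArg _ hvw

theorem eqRec_tangentSpace {x y : G} (h : x = y) (v : TangentSpace I x) :
    (⟨y, h ▸ v⟩ : TangentBundle I G) = ⟨x, v⟩ := by
  subst h; rfl

/-- Near `(g, β g)` the multiplication extends smoothly to an open subset of `G × G`. -/
theorem exists_mul_extension [I.Boundaryless] (Q : SmoothQuasiloopoid I J G M) (g₀ : G) :
    ∃ (μ : G × G → G) (V : Set (G × G)), IsOpen V ∧ (g₀, Q.ε (Q.β g₀)) ∈ V ∧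
      ContMDiffOn (I.prod I) I ∞ μ V ∧
      ∀ p ∈ V, Q.β p.1 = Q.α p.2 → μ p = Q.mul p.1 p.2 := by
  obtain ⟨ρ, U, hUo, hxU, hρ, hαρ, hρα⟩ :=
    (Q.isSubmersion_α.isSubmersionAt (Q.ε (Q.β g₀))).exists_fibre_retractions
  rw [Q.α_ε] at hxU
  have hκ : ContMDiff (I.prod I) (J.prod I) ∞ (fun p : G × G => (Q.β p.1, p.2)) :=
    (Q.isSubmersion_β.contMDiff.comp contMDiff_fst).prodMk contMDiff_snd
  -- Retract the second factor onto the fibre `α⁻¹(β g)` before multiplying; on composable pairs the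
  -- retraction changes nothing.
  refine ⟨fun p => Q.mul p.1 (ρ (Q.β p.1, p.2)), (fun p : G × G => (Q.β p.1, p.2)) ⁻¹' U,
    hUo.preimage hκ.continuous, hxU, ?_, ?_⟩
  · have h1 : ContMDiffOn (I.prod I) I ∞ (fun p : G × G => ρ (Q.β p.1, p.2))
        ((fun p : G × G => (Q.β p.1, p.2)) ⁻¹' U) :=
      hρ.comp hκ.contMDiffOn fun p hp => hp
    exact Q.smooth_mul.comp (contMDiff_fst.contMDiffOn.prodMk h1) fun p hp => (hαρ _ hp).symm
  · intro p hp hpc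
    have h2 : ρ (Q.α p.2, p.2) = p.2 := hρα _ (by rw [← hpc]; exact hp)
    change Q.mul p.1 (ρ (Q.β p.1, p.2)) = _
    rw [hpc, h2]

theorem mdifferentiableWithinAt_mul_left (Q : SmoothQuasiloopoid I J G M) {g h : G}
    (hgh : Q.β g = Q.α h) :
    MDifferentiableWithinAt I I (fun h' => Q.mul g h') (Q.α ⁻¹' {Q.β g}) h := by
  have h1 : ContMDiffWithinAt I I ∞ ((fun p : G × G => Q.mul p.1 p.2) ∘ fun h' => (g, h'))
      (Q.α ⁻¹' {Q.β g}) h :=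
    (Q.smooth_mul (g, h) hgh).comp h
      (contMDiffWithinAt_const.prodMk contMDiffWithinAt_id) fun h' hh' => Eq.symm hh'
  exact h1.mdifferentiableWithinAt (by simp)

section Smooth

variable [IsManifold I ∞ G] [IsManifold J ∞ M]

/-- The representatives of a smooth section of `AG` tangent to the `α`-fibres form a smooth section
of `TG` along the units. -/
theorem contMDiff_alphaRep (Q : SmoothQuasiloopoid I J G M) (X : Q.NormalSection) :
    ContMDiff J I.tangent ∞
      (fun b => (⟨Q.ε b, Q.alphaRep b (X.toFun b)⟩ : TangentBundle I G)) := by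
  intro a
  obtain ⟨U, hU, Y, hY, hYX⟩ := X.smooth a
  have hY' : ContMDiffWithinAt J I.tangent ∞
      (fun b => (⟨Q.ε b, Y b⟩ : TangentBundle I G)) U a := hY a (mem_of_mem_nhds hU)
  have hα := Q.isSubmersion_α.contMDiff.contMDiff_tangentMap (m := ∞) (by simp)
  have hε := Q.contMDiff_ε.contMDiff_tangentMap (m := ∞) (by simp)
  have hW : ContMDiffWithinAt J I.tangent ∞ (fun b => (⟨Q.ε b,
      mfderiv J I Q.ε b (show F from mfderiv I J Q.α (Q.ε b) (Y b))⟩ : TangentBundle I G)) U a := by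
    convert (hε.comp hα).contMDiffAt.comp_contMDiffWithinAt a hY' using 1
    funext b
    -- `Tα (Y b)` lies over `α (ε b)`, which equals `b` only propositionally.
    have key : ∀ (c : M) (w : F), c = b →
        (⟨Q.ε b, mfderiv J I Q.ε b w⟩ : TangentBundle I G) = tangentMap J I Q.ε ⟨c, w⟩ := by
      rintro _ w rfl; rfl
    exact key _ _ (Q.α_ε b)
  refine ((hY'.sub_section_along hW).congr_of_mem (fun b hb => ?_)
    (mem_of_mem_nhds hU)).contMDiffAt hU
  rw [← hYX b hb, alphaRep_mk]

variable [I.Boundaryless]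

/-- Locally this is `Tμ` applied to the zero vector at `g` and `X̄^α(β g)`, a composite of smooth
maps. -/
theorem contMDiff_leftProlongation (Q : SmoothQuasiloopoid I J G M) (X : Q.NormalSection) :
    ContMDiff I I.tangent ∞
      (fun g => (⟨g, Q.leftProlongation X g⟩ : TangentBundle I G)) := by
  intro g₀
  obtain ⟨μ, V, hVo, hgV, hμ, hμm⟩ := Q.exists_mul_extension g₀
  have hT := hμ.contMDiffOn_tangentMapWithin (m := ∞) (by simp) hVo.uniqueMDiffOn
  have hκ : ContMDiff I (I.prod I) ∞ (fun g => (g, Q.ε (Q.β g))) :=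
    contMDiff_id.prodMk (Q.contMDiff_ε.comp Q.isSubmersion_β.contMDiff)
  have hW : ContMDiff I (I.prod I).tangent ∞ (fun g => ((equivTangentBundleProd I G I G).symm
      ((⟨g, 0⟩ : TangentBundle I G), (⟨Q.ε (Q.β g), Q.alphaRep (Q.β g) (X.toFun (Q.β g))⟩ :
        TangentBundle I G)))) :=
    contMDiff_equivTangentBundleProd_symm.comp
      ((Bundle.contMDiff_zeroSection ℝ (TangentSpace I)).prodMk
        ((Q.contMDiff_alphaRep X).comp Q.isSubmersion_β.contMDiff))
  have hO : IsOpen ((fun g => (g, Q.ε (Q.β g))) ⁻¹' V) := hVo.preimage hκ.continuous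
  refine ((hT.comp hW.contMDiffOn (s := (fun g => (g, Q.ε (Q.β g))) ⁻¹' V) fun g hg => hg).congr
    fun g hg => ?_).contMDiffAt (hO.mem_nhds hgV)
  have hg' : (g, Q.ε (Q.β g)) ∈ V := hg
  have hgc : Q.β g = Q.α (Q.ε (Q.β g)) := (Q.α_ε _).symm
  rw [leftProlongation, eqRec_tangentSpace]
  have hμd : MDifferentiableAt (I.prod I) I μ (g, Q.ε (Q.β g)) :=
    (hμ.contMDiffAt (hVo.mem_nhds hg')).mdifferentiableAt (by simp)
  have hι : HasMFDerivAt I (I.prod I) (fun h => (g, h)) (Q.ε (Q.β g)) _ :=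
    (hasMFDerivAt_const g _).prodMk (hasMFDerivAt_id _)
  have h1 := HasMFDerivAt.comp (f := fun h => (g, h)) (Q.ε (Q.β g)) hμd.hasMFDerivAt hι
  have h2 := (Q.mdifferentiableWithinAt_mul_left hgc).hasMFDerivWithinAt
  -- `l_g` and `μ (g, ·)` agree on the `α`-fibre near the unit, so their derivatives agree on the
  -- vertical vector `X̄^α`.
  have h4 := (Q.isSubmersion_α.isSubmersionAt (Q.ε (Q.β g))).hasMFDerivWithinAt_fibre_eq
    (Q.α_ε _) h2 h1.hasMFDerivWithinAt (by
      filter_upwards [self_mem_nhdsWithin, mem_nhdsWithin_of_mem_nhds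
        (hι.continuousAt.preimage_mem_nhds (hVo.mem_nhds hg'))] with h hh hhV
      exact (hμm _ hhV (hh.symm)).symm) _
    (Q.mfderiv_α_alphaRep (Q.β g) (X.toFun (Q.β g)))
  refine tangentBundle_mk_eq (hμm _ hg' hgc).symm (h4.trans ?_)
  change mfderiv (I.prod I) I μ (g, Q.ε (Q.β g)) _ =
    mfderivWithin (I.prod I) I μ V (g, Q.ε (Q.β g)) _
  rw [mfderivWithin_of_isOpen hVo hg']
  rfl

end Smooth
end SmoothQuasiloopoid

/-! ### Algebra of the inversion -/

namespace SmoothQuasiloopoid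

variable {E : Type*} [NormedAddCommGroup E] [NormedSpace ℝ E] {H : Type*} [TopologicalSpace H]
  {I : ModelWithCorners ℝ E H}
  {F : Type*} [NormedAddCommGroup F] [NormedSpace ℝ F] {K : Type*} [TopologicalSpace K]
  {J : ModelWithCorners ℝ F K}
  {G : Type*} [TopologicalSpace G] [ChartedSpace H G]
  {M : Type*} [TopologicalSpace M] [ChartedSpace K M]

theorem mdifferentiableWithinAt_mul_right (Q : SmoothQuasiloopoid I J G M) {g h : G}
    (hgh : Q.β g = Q.α h) :
    MDifferentiableWithinAt I I (fun g' => Q.mul g' h) (Q.β ⁻¹' {Q.α h}) g := by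
  have h1 : ContMDiffWithinAt I I ∞ ((fun p : G × G => Q.mul p.1 p.2) ∘ fun g' => (g', h))
      (Q.β ⁻¹' {Q.α h}) g :=
    (Q.smooth_mul (g, h) hgh).comp g
      (contMDiffWithinAt_id.prodMk contMDiffWithinAt_const) fun g' hg' => hg'
  exact h1.mdifferentiableWithinAt (by simp)

theorem eqRec_tangentSpace_eq {x y : G} (h : x = y) (v : TangentSpace I x) :
    ((h ▸ v : TangentSpace I y) : E) = v := by
  subst h; rfl

namespace IsInverse

variable {Q : SmoothQuasiloopoid I J G M} {ι : G ≃ₘ⟮I, I⟯ G}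

/-- Composability of `g⁻¹(gh)` when `h` is the unit `β(g)`, so that `gh = g`. -/
theorem β_inv (hι : Q.IsInverse ι) (g : G) : Q.β (ι g) = Q.α g := by
  rw [hι.composable_left g (Q.ε (Q.β g)) (Q.α_ε _).symm, Q.mul_unit]

theorem α_inv (hι : Q.IsInverse ι) (g : G) : Q.α (ι g) = Q.β g := by
  rw [← hι.composable_right (Q.ε (Q.α g)) g (Q.β_ε _), Q.unit_mul]

theorem β_mul (hι : Q.IsInverse ι) {g h : G} (hgh : Q.β g = Q.α h) :
    Q.β (Q.mul g h) = Q.β h := by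
  rw [hι.composable_right g h hgh, hι.α_inv]

/-- Cancelling in `(g⁻¹(gh))(gh)⁻¹` on either side gives `h(gh)⁻¹ = g⁻¹`; multiply by `h⁻¹` on the
left and cancel again. -/
theorem inv_mul_rev (hι : Q.IsInverse ι) {g h : G} (hgh : Q.β g = Q.α h) :
    ι (Q.mul g h) = Q.mul (ι h) (ι g) := by
  have h1 := hι.mul_inv (ι g) (Q.mul g h) (hι.composable_left g h hgh)
  rw [hι.inv_mul g h hgh] at h1
  have h2 := hι.inv_mul h (ι (Q.mul g h)) (by rw [hι.α_inv, hι.β_mul hgh])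
  rw [h1] at h2
  exact h2.symm

theorem inv_mul_self (hι : Q.IsInverse ι) (g : G) : Q.mul (ι g) g = Q.ε (Q.β g) := by
  have h := hι.inv_mul g (Q.ε (Q.β g)) (Q.α_ε _).symm
  rwa [Q.mul_unit] at h

/-- The product `a⁻¹a` is the unit `a` by `inv_mul_self`, and it is `a⁻¹` because its right factor
is a unit. -/
theorem inv_ε (hι : Q.IsInverse ι) (a : M) : ι (Q.ε a) = Q.ε a := by
  have h1 := hι.inv_mul_self (Q.ε a)
  have h2 := Q.mul_unit (ι (Q.ε a))
  rw [hι.β_inv, Q.α_ε] at h2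
  rw [Q.β_ε, h2] at h1
  exact h1

/-! ### The derivative of the inversion at the units -/

theorem hasMFDerivAt_inv (ι : G ≃ₘ⟮I, I⟯ G) (g : G) : HasMFDerivAt I I ι g (mfderiv I I ι g) :=
  (ι.contMDiff.mdifferentiable (by simp) g).hasMFDerivAt

/-- The inversion fixes the tangent vectors of the units. -/
theorem mfderiv_inv_ε (hι : Q.IsInverse ι) (a : M) (u : F) :
    (mfderiv I I ι (Q.ε a) (mfderiv J I Q.ε a u) : E) = mfderiv J I Q.ε a u := by
  have hε : HasMFDerivAt J I Q.ε a _ := (Q.contMDiff_ε.mdifferentiable (by simp) a).hasMFDerivAt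
  have h1 := (hasMFDerivAt_inv ι (Q.ε a)).comp a hε
  have h2 : HasMFDerivAt J I (ι ∘ Q.ε) a (mfderiv J I Q.ε a : F →L[ℝ] E) := by
    rw [show ι ∘ Q.ε = Q.ε from funext hι.inv_ε]; exact hε
  exact DFunLike.congr_fun (hasMFDerivAt_unique h1 h2) u

theorem mfderiv_β_inv (hι : Q.IsInverse ι) (a : M) (v : E) :
    (mfderiv I J Q.β (Q.ε a) (mfderiv I I ι (Q.ε a) v : E) : F) = mfderiv I J Q.α (Q.ε a) v := by
  have hβ : HasMFDerivAt I J Q.β (ι (Q.ε a)) (mfderiv I J Q.β (Q.ε a) : E →L[ℝ] F) := by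
    rw [hι.inv_ε]
    exact (Q.isSubmersion_β.contMDiff.mdifferentiable (by simp) _).hasMFDerivAt
  have h1 := hβ.comp (Q.ε a) (hasMFDerivAt_inv ι (Q.ε a))
  have h2 : HasMFDerivAt I J (Q.β ∘ ι) (Q.ε a) (mfderiv I J Q.α (Q.ε a) : E →L[ℝ] F) := by
    rw [show Q.β ∘ ι = Q.α from funext hι.β_inv]
    exact (Q.isSubmersion_α.contMDiff.mdifferentiable (by simp) _).hasMFDerivAt
  exact DFunLike.congr_fun (hasMFDerivAt_unique h1 h2) v

section

variable [I.Boundaryless] [IsManifold I ∞ G]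

/-- On a vector tangent to the `α`-fibre the inversion is `-1` modulo the tangent vectors of the
units. -/
theorem mfderiv_inv_of_mfderiv_α_eq_zero (hι : Q.IsInverse ι) (a : M) (v : TangentSpace I (Q.ε a))
    (hv : mfderiv I J Q.α (Q.ε a) v = 0) :
    (show E from mfderiv I I ι (Q.ε a) v) + (show E from v) =
      mfderiv J I Q.ε a (show F from mfderiv I J Q.β (Q.ε a) v) := by
  obtain ⟨θ, θ', hθx, hθ, hθd, hθv⟩ :=
    (Q.isSubmersion_α.isSubmersionAt (Q.ε a)).exists_fibre_retraction
  rw [Q.α_ε] at hθ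
  have hmd : MDifferentiableWithinAt (I.prod I) I (fun p : G × G => Q.mul p.1 p.2)
      {p | Q.β p.1 = Q.α p.2} (Q.ε a, Q.ε a) :=
    (Q.smooth_mul _ ((Q.β_ε a).trans (Q.α_ε a).symm)).mdifferentiableWithinAt (by simp)
  obtain ⟨D, hD⟩ : ∃ D : E × E →L[ℝ] E, HasMFDerivWithinAt (I.prod I) I
      (fun p : G × G => Q.mul p.1 p.2) {p | Q.β p.1 = Q.α p.2} (Q.ε a, Q.ε a) D :=
    ⟨_, hmd.hasMFDerivWithinAt⟩
  -- Chain rule for the product along composable pairs `c y` with product `m y`. One fixed `D`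
  -- serves every such family, so its non-uniqueness as a derivative within `G⁽²⁾` is harmless.
  have key : ∀ (c : G → G × G) (c' : E →L[ℝ] E × E) (m : G → G) (m' : E →L[ℝ] E),
      c (Q.ε a) = (Q.ε a, Q.ε a) → HasMFDerivAt I (I.prod I) c (Q.ε a) c' →
      HasMFDerivAt I I m (Q.ε a) m' →
      (∀ y, Q.α (θ y) = a → Q.β (c y).1 = Q.α (c y).2 ∧ Q.mul (c y).1 (c y).2 = m y) →
      D (c' v) = m' v := by
    intro c c' m m' hcx hc hm hcm
    have hD' : HasMFDerivWithinAt (I.prod I) I (fun p : G × G => Q.mul p.1 p.2)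
      {p | Q.β p.1 = Q.α p.2} (c (Q.ε a)) D := by rw [hcx]; exact hD
    have h1 := (hD'.comp (Q.ε a) (hc.hasMFDerivWithinAt (s := {y | Q.α (θ y) = a}))
      fun y hy => (hcm y hy).1).hasMFDerivAt hθ
    have h2 := h1.congr_of_eventuallyEq (f₁ := m) (by
      filter_upwards [hθ] with y hy using (hcm y hy).2.symm)
    exact DFunLike.congr_fun (hasMFDerivAt_unique h2 hm) v
  have hιθ : HasMFDerivAt I I (fun y => ι (θ y)) (Q.ε a)
      ((mfderiv I I ι (Q.ε a) : E →L[ℝ] E).comp θ') := by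
    have : HasMFDerivAt I I ι (θ (Q.ε a)) (mfderiv I I ι (Q.ε a) : E →L[ℝ] E) := by
      rw [hθx]; exact hasMFDerivAt_inv ι _
    exact this.comp _ hθd
  have hεβθ : HasMFDerivAt I I (fun y => Q.ε (Q.β (θ y))) (Q.ε a)
      ((mfderiv J I Q.ε a : F →L[ℝ] E).comp ((mfderiv I J Q.β (Q.ε a) : E →L[ℝ] F).comp θ')) := by
    have h1 : HasMFDerivAt I J Q.β (θ (Q.ε a)) (mfderiv I J Q.β (Q.ε a) : E →L[ℝ] F) := by
      rw [hθx]
      exact (Q.isSubmersion_β.contMDiff.mdifferentiable (by simp) _).hasMFDerivAt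
    have h2 : HasMFDerivAt J I Q.ε (Q.β (θ (Q.ε a))) (mfderiv J I Q.ε a : F →L[ℝ] E) := by
      rw [hθx, Q.β_ε]
      exact (Q.contMDiff_ε.mdifferentiable (by simp) a).hasMFDerivAt
    exact h2.comp (Q.ε a) (h1.comp (Q.ε a) hθd)
  -- For `h = θ y` in the `α`-fibre of `a`, differentiate `h⁻¹h = β(h)`, `h⁻¹a = h⁻¹` and `ah = h`.
  -- Additivity of `D` combines the last two into the first.
  have e1 := key (fun y => (ι (θ y), θ y)) _ _ _ (by simp only [hθx, hι.inv_ε])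
    (hιθ.prodMk hθd) hεβθ fun y _ => ⟨hι.β_inv _, hι.inv_mul_self _⟩
  have e2 := key (fun y => (ι (θ y), Q.ε a)) _ _ _ (by simp only [hθx, hι.inv_ε])
    (hιθ.prodMk (hasMFDerivAt_const _ _)) hιθ fun y hy => by
      have h1 : Q.β (ι (θ y)) = a := (hι.β_inv _).trans hy
      refine ⟨h1.trans (Q.α_ε a).symm, ?_⟩
      have h2 := Q.mul_unit (ι (θ y))
      rwa [h1] at h2
  have e3 := key (fun y => (Q.ε a, θ y)) _ _ _ (by simp only [hθx])
    ((hasMFDerivAt_const _ _).prodMk hθd) hθd fun y hy => by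
      refine ⟨(Q.β_ε a).trans hy.symm, ?_⟩
      have h2 := Q.unit_mul (θ y)
      rwa [hy] at h2
  have hv' := hθv v hv
  change D ((mfderiv I I ι (Q.ε a) : E →L[ℝ] E) (θ' v), θ' v) =
    (mfderiv J I Q.ε a : F →L[ℝ] E) ((mfderiv I J Q.β (Q.ε a) : E →L[ℝ] F) (θ' v)) at e1
  change D ((mfderiv I I ι (Q.ε a) : E →L[ℝ] E) (θ' v), 0) =
    (mfderiv I I ι (Q.ε a) : E →L[ℝ] E) (θ' v) at e2
  change D (0, θ' v) = θ' v at e3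
  have hv'' : θ' v = (v : E) := hv'
  rw [hv''] at e1 e2 e3
  have hD2 : ∀ x y : E, D (x, 0) + D (0, y) = D (x, y) := fun x y => by
    rw [← map_add, Prod.mk_add_mk, add_zero, zero_add]
  exact (congrArg₂ (fun x y : E => x + y) e2.symm e3.symm).trans ((hD2 _ _).trans e1)

/-- The inversion induces `-1` on the normal bundle of the units. -/
theorem mk_mfderiv_inv (hι : Q.IsInverse ι) (a : M) (w : TangentSpace I (Q.ε a)) :
    (Submodule.Quotient.mk (show TangentSpace I (Q.ε a) from mfderiv I I ι (Q.ε a) w) :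
      Q.Normal a) = -Submodule.Quotient.mk w := by
  set u : F := mfderiv I J Q.α (Q.ε a) w
  obtain ⟨v, hv, hvw⟩ : ∃ v : TangentSpace I (Q.ε a), mfderiv I J Q.α (Q.ε a) v = 0 ∧
      v = w - mfderiv J I Q.ε a u :=
    ⟨_, Q.mfderiv_α_alphaRep a (Submodule.Quotient.mk w), Q.alphaRep_mk a w⟩
  have h1 := hι.mfderiv_inv_of_mfderiv_α_eq_zero a v hv
  have h2 := hι.mfderiv_inv_ε a u
  have hw : w = v + mfderiv J I Q.ε a u := by rw [hvw]; abel
  rw [← Submodule.Quotient.mk_neg, Submodule.Quotient.eq]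
  -- With `w = v + Tε u` and `v` vertical, `Tι w + w = (Tι v + v) + 2 Tε u = Tε (Tβ v + 2u)`.
  refine ⟨(show F from mfderiv I J Q.β (Q.ε a) v) + (u + u), ?_⟩
  have key : ∀ (A : E →L[ℝ] E) (B : F →L[ℝ] E) (v w : E) (u b : F), A v + v = B b →
      A (B u) = B u → w = v + B u → B (b + (u + u)) = A w - -w := by
    rintro A B v w u b h1 h2 rfl
    rw [map_add, map_add, map_add, h2, ← h1]
    abel
  exact key _ _ _ _ _ _ h1 h2 hw

/-! ### The inversion exchanges the prolongations -/

/-- `Tι` maps `ker Tα` into `ker Tβ` because `β ∘ ι = α`, and it is `-1` on `AG`; the sign restores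
the class. -/
theorem betaRep_eq (hι : Q.IsInverse ι) (a : M) (x : Q.Normal a) :
    (Q.betaRep a x : E) = -(mfderiv I I ι (Q.ε a) (Q.alphaRep a x) : E) := by
  refine (Q.eq_betaRep (v := -(show TangentSpace I (Q.ε a) from
    mfderiv I I ι (Q.ε a) (Q.alphaRep a x))) ?_ ?_).symm
  · rw [map_neg, neg_eq_zero]
    exact (hι.mfderiv_β_inv a _).trans (Q.mfderiv_α_alphaRep a x)
  · rw [Submodule.Quotient.mk_neg, hι.mk_mfderiv_inv, neg_neg, Q.mk_alphaRep]

/-- The inversion exchanges left and right prolongations, up to sign. -/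
theorem rightProlongation_inv (hι : Q.IsInverse ι) (X : Q.NormalSection) (g : G) :
    Q.rightProlongation X (ι g) = -mfderiv I I ι g (Q.leftProlongation X g) := by
  let b := Q.β g
  let v : E := Q.alphaRep b (X.toFun b)
  have hgc : Q.β g = Q.α (Q.ε (Q.β g)) := (Q.α_ε _).symm
  let L : E →L[ℝ] E := mfderivWithin I I (fun h => Q.mul g h) (Q.α ⁻¹' {b}) (Q.ε b)
  have hL : HasMFDerivWithinAt I I (fun h => Q.mul g h) (Q.α ⁻¹' {b}) (Q.ε b) L :=
    (Q.mdifferentiableWithinAt_mul_left hgc).hasMFDerivWithinAt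
  let R : E →L[ℝ] E := mfderivWithin I I (fun h => Q.mul h (ι g)) (Q.β ⁻¹' {b}) (Q.ε b)
  have hR : HasMFDerivWithinAt I I (fun h => Q.mul h (ι g)) (Q.β ⁻¹' {b}) (ι (Q.ε b)) R := by
    rw [hι.inv_ε]
    have h := (Q.mdifferentiableWithinAt_mul_right (g := Q.ε b) (h := ι g)
      (by rw [Q.β_ε, hι.α_inv])).hasMFDerivWithinAt
    rwa [hι.α_inv] at h
  let A : E →L[ℝ] E := mfderiv I I ι g
  have hA : HasMFDerivAt I I ι (Q.mul g (Q.ε b)) A := by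
    rw [Q.mul_unit]; exact hasMFDerivAt_inv ι g
  let B : E →L[ℝ] E := mfderiv I I ι (Q.ε b)
  have hB : HasMFDerivAt I I ι (Q.ε b) B := hasMFDerivAt_inv ι _
  -- The derivative of `ι(h)ι(g) = ι(gh)` in `h` along the `α`-fibre, at the unit `b`.
  have key : (R.comp B) v = (A.comp L) v :=
    (Q.isSubmersion_α.isSubmersionAt (Q.ε b)).hasMFDerivWithinAt_fibre_eq (Q.α_ε b)
      (hR.comp (Q.ε b) hB.hasMFDerivWithinAt fun h hh => (hι.β_inv h).trans hh)
      (hA.comp_hasMFDerivWithinAt (Q.ε b) hL)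
      (by filter_upwards [self_mem_nhdsWithin] with h hh
          exact (hι.inv_mul_rev (Eq.symm hh)).symm) v
      (Q.mfderiv_α_alphaRep b (X.toFun b))
  have hl : (Q.leftProlongation X g : E) = L v :=
    eqRec_tangentSpace_eq (I := I) (Q.mul_unit g) _
  have hr : (Q.rightProlongation X (ι g) : E) = R (Q.betaRep b (X.toFun b)) := by
    refine (eqRec_tangentSpace_eq (I := I) (Q.unit_mul (ι g)) _).trans ?_
    exact congrArg (fun c => (show E from mfderivWithin I I (fun h => Q.mul h (ι g)) (Q.β ⁻¹' {c})
      (Q.ε c) (Q.betaRep c (X.toFun c)))) (hι.α_inv g)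
  have hb : (Q.betaRep b (X.toFun b) : E) = -B v := hι.betaRep_eq b _
  refine hr.trans ((congrArg R hb).trans ((map_neg R _).trans (congrArg (fun x : E => -x) ?_)))
  exact key.trans (congrArg A hl.symm)

/-- The pull-back of a right prolongation under the inversion. -/
theorem mpullback_rightProlongation (hι : Q.IsInverse ι) (X : Q.NormalSection) :
    VectorField.mpullback I I ι (Q.rightProlongation X) = (-1 : ℝ) • Q.leftProlongation X := by
  funext g
  rw [VectorField.mpullback_apply, hι.rightProlongation_inv,
    ← ι.mfderivToContinuousLinearEquiv_coe (by simp), ContinuousLinearMap.inverse_equiv]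
  simp

theorem contMDiff_rightProlongation [IsManifold J ∞ M] (hι : Q.IsInverse ι)
    (X : Q.NormalSection) :
    ContMDiff I I.tangent ∞
      (fun g => (⟨g, Q.rightProlongation X g⟩ : TangentBundle I G)) := by
  have h1 := (ι.contMDiff.contMDiff_tangentMap (m := ∞) (by simp)).comp
    ((Q.contMDiff_leftProlongation X).neg_section.comp ι.symm.contMDiff)
  convert h1 using 1
  funext g
  obtain ⟨g, rfl⟩ : ∃ g', ι g' = g := ⟨ι.symm g, ι.apply_symm_apply g⟩
  have h2 : ι.symm (ι g) = g := ι.symm_apply_apply g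
  rw [hι.rightProlongation_inv, ← map_neg, Function.comp_apply, Function.comp_apply, h2]
  rfl

/-! ### Comparison of the brackets -/

theorem leftBracket_eq_neg_rightBracket [FiniteDimensional ℝ E] [IsManifold J ∞ M]
    (hι : Q.IsInverse ι) (X Y : Q.NormalSection) (a : M) :
    Q.leftBracket X Y a = -Q.rightBracket X Y a := by
  have : IsManifold I (minSmoothness ℝ 2) G := by
    rw [minSmoothness_of_isRCLikeNormedField]
    exact IsManifold.of_le (n := ∞) (by exact WithTop.coe_le_coe.2 le_top)
  have : CompleteSpace E := FiniteDimensional.complete ℝ E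
  have hl := fun X : Q.NormalSection =>
    (Q.contMDiff_leftProlongation X).mdifferentiable (by simp) (Q.ε a)
  have hr := fun X : Q.NormalSection =>
    (hι.contMDiff_rightProlongation X).mdifferentiable (by simp) (ι (Q.ε a))
  have h1 := VectorField.mpullback_mlieBracket (hr X) (hr Y) (ι.contMDiff (Q.ε a))
    (by rw [minSmoothness_of_isRCLikeNormedField]; exact WithTop.coe_le_coe.2 le_top)
  have h2 : VectorField.mlieBracket I ((-1 : ℝ) • Q.leftProlongation X)
      ((-1 : ℝ) • Q.leftProlongation Y) (Q.ε a) =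
      VectorField.mlieBracket I (Q.leftProlongation X) (Q.leftProlongation Y) (Q.ε a) := by
    rw [VectorField.mlieBracket_const_smul_left (hl X),
      VectorField.mlieBracket_const_smul_right (hl Y), smul_smul]
    simp
  have hinv : (mfderiv I I ι (Q.ε a)).IsInvertible :=
    ⟨ι.mfderivToContinuousLinearEquiv (by simp) _, rfl⟩
  rw [hι.mpullback_rightProlongation, hι.mpullback_rightProlongation, h2,
    VectorField.mpullback_apply, hinv.inverse_apply_eq] at h1
  -- Naturality gives the bracket at `ι (ε a)`; since `ι` fixes units, it is the bracket at `ε a`.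
  have h3 : (VectorField.mlieBracket I (Q.rightProlongation X) (Q.rightProlongation Y)
      (Q.ε a) : E) = mfderiv I I ι (Q.ε a)
        (VectorField.mlieBracket I (Q.leftProlongation X) (Q.leftProlongation Y) (Q.ε a)) :=
    (congrArg (fun x => (show E from VectorField.mlieBracket I (Q.rightProlongation X)
      (Q.rightProlongation Y) x)) (hι.inv_ε a).symm).trans h1
  rw [rightBracket, leftBracket, eq_comm, neg_eq_iff_eq_neg]
  exact (congrArg (fun w : TangentSpace I (Q.ε a) => (Submodule.Quotient.mk w : Q.Normal a))
    h3).trans (hι.mk_mfderiv_inv a _)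

end

end IsInverse
end SmoothQuasiloopoid

theorem mainTheorem4
    {E : Type*} [NormedAddCommGroup E] [NormedSpace ℝ E] [FiniteDimensional ℝ E]
    {H : Type*} [TopologicalSpace H] {I : ModelWithCorners ℝ E H} [I.Boundaryless]
    {F : Type*} [NormedAddCommGroup F] [NormedSpace ℝ F] [FiniteDimensional ℝ F]
    {K : Type*} [TopologicalSpace K] {J : ModelWithCorners ℝ F K} [J.Boundaryless]
    {G : Type*} [TopologicalSpace G] [ChartedSpace H G] [IsManifold I ∞ G]
    [T2Space G] [SecondCountableTopology G]
    {M : Type*} [TopologicalSpace M] [ChartedSpace K M] [IsManifold J ∞ M]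
    [T2Space M] [SecondCountableTopology M]
    (Q : SmoothQuasiloopoid I J G M) (hQ : Q.HasInverseProperty) :
    (∀ X : Q.NormalSection,
      ContMDiff I I.tangent ∞ (fun g => (⟨g, Q.leftProlongation X g⟩ : TangentBundle I G)) ∧
      ContMDiff I I.tangent ∞ (fun g => (⟨g, Q.rightProlongation X g⟩ : TangentBundle I G))) ∧
    ∀ (X Y : Q.NormalSection) (a : M), Q.leftBracket X Y a = -Q.rightBracket X Y a := by
  obtain ⟨ι, hι⟩ := hQ
  exact ⟨fun X => ⟨Q.contMDiff_leftProlongation X, hι.contMDiff_rightProlongation X⟩,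
    hι.leftBracket_eq_neg_rightBracket⟩
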